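/- Let $\alpha\in(0,1)$ and let $X$ be a totally asymmetric $\alpha$-stable random variable, that is, a real random variable with characteristic function $$\mathbb{E}\,e^{itX}=\exp\Big(\int_0^\infty (e^{itx}-1)\,\frac{dx}{x^{\alpha+1}}\Big),\qquad t\in\mathbb{R}.$$ Then for every $y\ge (1/\alpha)^{1/\alpha}$, $$\mathbb{P}\Big(X>\frac{1}{1-\alpha}+3y\Big)\le \frac{2}{\alpha y^{\alpha}}.$$ Moreover, for every $y\ge 1$ and every $\theta\in(0,1)$, $$\mathbb{P}\Big(X\ge \frac{\theta}{1-\alpha}+y\Big)\ge \frac{2}{3}(1-\theta)^2\,\frac{1}{1+\alpha y^{\alpha}}.$$ -/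

import Mathlib

open MeasureTheory

/-- The characteristic exponent `∫_0^∞ (e^{itx} - 1) x^{-α-1} dx` of the strictly `α`-stable law
with Lévy measure `x^{-α-1} 1_{(0,∞)}(x) dx`. The integral converges absolutely for `0 < α < 1`. -/
noncomputable def stableExponent (α t : ℝ) : ℂ :=
  ∫ x in Set.Ioi (0 : ℝ),
    (Complex.exp (Complex.I * (t : ℂ) * (x : ℂ)) - 1) * ((1 / x ^ (α + 1) : ℝ) : ℂ)

/-- `X` is a totally asymmetric `α`-stable random variable (for `0 < α < 1`): its characteristic
function is `t ↦ exp (∫_0^∞ (e^{itx} - 1) x^{-α-1} dx)`. -/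
structure IsTotallyAsymmetricStable {Ω : Type*} [MeasurableSpace Ω]
    (α : ℝ) (X : Ω → ℝ) (P : Measure Ω) : Prop where
  aemeasurable : AEMeasurable X P
  charFun_eq : ∀ t : ℝ, charFun (P.map X) t = Complex.exp (stableExponent α t)

/-!
The law is infinitely divisible with Lévy measure `ν = x^{-α-1} dx` on `(0, ∞)`, so `X` behaves like
the sum of the points of a Poisson process with intensity `ν`. Cut the jumps at a level `R`: those
smaller than `R` have total mean `∫_{x < R} x dν` and variance `∫_{x < R} x² dν`, and independently
of them the number of jumps in a set `s ⊆ [R, ∞)` is Poisson with parameter `ν s`.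

For the upper bound take `R = y`: either there is a jump of size at least `y`, or Chebyshev's
inequality applies to the small jumps. For the lower bound take `R = 1`: Cantelli's inequality
keeps the sum of the small jumps above `θ / (1 - α)`, and independently some jump has size at least
`y`, with probability `1 - exp (-ν [y, ∞)) ≥ 1 / (1 + α y ^ α)`.

To avoid constructing the Poisson process, both steps are carried out for sums of finitely many
i.i.d. variables, each of them nonzero with small probability, whose laws converge weakly by Lévy's
continuity theorem.
-/

open Filter Topology ProbabilityTheory Set

section Limits

lemma tendsto_one_add_div_pow_exp_of_tendsto {ι : Type*} {l : Filter ι} {N : ι → ℕ} {z : ι → ℂ}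
    {w : ℂ} (hN : Tendsto N l atTop) (hz : Tendsto z l (𝓝 w)) :
    Tendsto (fun i ↦ (1 + z i / N i) ^ N i) l (𝓝 (Complex.exp w)) := by
  have hbase : Tendsto (fun i ↦ 1 + z i / N i) l (𝓝 1) := by
    have hinv : Tendsto (fun i ↦ (N i : ℂ)⁻¹) l (𝓝 0) :=
      (tendsto_inv_atTop_nhds_zero_nat (𝕜 := ℂ)).comp hN
    simpa [div_eq_mul_inv] using (hz.mul hinv).const_add 1
  have hslope : Tendsto (fun i ↦ dslope Complex.log 1 (1 + z i / N i)) l (𝓝 1) := by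
    have hlog := Complex.hasDerivAt_log Complex.one_mem_slitPlane
    have := (continuousAt_dslope_same.2 hlog.differentiableAt).tendsto.comp hbase
    simpa [dslope_same, hlog.deriv, Function.comp_def] using this
  have hexp := (hz.mul hslope).cexp
  rw [mul_one] at hexp
  refine hexp.congr' ?_
  filter_upwards [hN.eventually_ge_atTop 1, hbase.eventually_ne one_ne_zero] with i hi hne
  have hNi : (N i : ℂ) ≠ 0 := by exact_mod_cast (by lia : N i ≠ 0)
  have hlog : z i * dslope Complex.log 1 (1 + z i / N i)
      = N i * Complex.log (1 + z i / N i) := by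
    have := sub_smul_dslope Complex.log 1 (1 + z i / N i)
    rw [Complex.log_one, sub_zero, add_sub_cancel_left, smul_eq_mul] at this
    rw [← this]
    field_simp
  rw [hlog, Complex.exp_nat_mul, Complex.exp_log hne]

variable {E : Type*} [NormedAddCommGroup E] [InnerProductSpace ℝ E] [FiniteDimensional ℝ E]
  [MeasurableSpace E] [BorelSpace E] {μ : Measure E} [IsProbabilityMeasure μ]
  {μs : ℕ → Measure E} [∀ k, IsProbabilityMeasure (μs k)]

lemma measureReal_le_of_tendsto_charFun
    (hlim : ∀ t, Tendsto (fun k ↦ charFun (μs k) t) atTop (𝓝 (charFun μ t)))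
    {G : Set E} (hG : IsOpen G) {b : ℝ} (hb : ∀ k, (μs k).real G ≤ b) : μ.real G ≤ b := by
  have hweak := ProbabilityMeasure.tendsto_of_tendsto_charFun
    (μ := fun k ↦ ⟨μs k, inferInstance⟩) (μ₀ := ⟨μ, inferInstance⟩) hlim
  refine ENNReal.toReal_le_of_le_ofReal (measureReal_nonneg.trans (hb 0)) ?_
  calc μ G ≤ liminf (fun k ↦ μs k G) atTop :=
        ProbabilityMeasure.le_liminf_measure_open_of_tendsto hweak hG
    _ ≤ ENNReal.ofReal b := liminf_le_of_frequently_le' <| Frequently.of_forall fun k ↦ by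
        rw [← ofReal_measureReal]
        exact ENNReal.ofReal_le_ofReal (hb k)

lemma le_measureReal_of_tendsto_charFun
    (hlim : ∀ t, Tendsto (fun k ↦ charFun (μs k) t) atTop (𝓝 (charFun μ t)))
    {F : Set E} (hF : IsClosed F) {b : ℕ → ℝ} {b' : ℝ} (hb : Tendsto b atTop (𝓝 b'))
    (hle : ∀ᶠ k in atTop, b k ≤ (μs k).real F) : b' ≤ μ.real F := by
  have hweak := ProbabilityMeasure.tendsto_of_tendsto_charFun
    (μ := fun k ↦ ⟨μs k, inferInstance⟩) (μ₀ := ⟨μ, inferInstance⟩) hlim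
  refine (ENNReal.ofReal_le_iff_le_toReal (measure_ne_top _ _)).1 ?_
  calc ENNReal.ofReal b' = limsup (fun k ↦ ENNReal.ofReal (b k)) atTop :=
        (ENNReal.tendsto_ofReal hb).limsup_eq.symm
    _ ≤ limsup (fun k ↦ μs k F) atTop := limsup_le_limsup <| hle.mono fun k hk ↦ by
        beta_reduce
        rw [← ofReal_measureReal (μ := μs k)]
        exact ENNReal.ofReal_le_ofReal hk
    _ ≤ μ F := ProbabilityMeasure.limsup_measure_closed_le_of_tendsto hweak hF

end Limits

section SecondMoment

variable {Ω : Type*} [MeasurableSpace Ω] {μ : Measure Ω} {X : Ω → ℝ}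

lemma sq_integral_le_integral_sq_mul_measureReal [IsFiniteMeasure μ] (hX : MemLp X 2 μ)
    (h0 : 0 ≤ μ[X]) : μ[X] ^ 2 ≤ μ[X ^ 2] * μ.real {ω | 0 ≤ X ω} := by
  have hS : NullMeasurableSet {ω | 0 ≤ X ω} μ := nullMeasurableSet_le aemeasurable_const
    hX.aemeasurable
  have hX1 : Integrable X μ := hX.integrable one_le_two
  have hquad (c : ℝ) :
      0 ≤ μ.real {ω | 0 ≤ X ω} * (c * c) + -(2 * μ[X]) * c + μ[X ^ 2] := by
    rcases le_total c 0 with hc | hc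
    · have hsq : 0 ≤ μ[X ^ 2] := integral_nonneg fun ω ↦ sq_nonneg (X ω)
      have := mul_nonneg h0 (neg_nonneg.2 hc)
      have := mul_nonneg (measureReal_nonneg (μ := μ) (s := {ω | 0 ≤ X ω})) (mul_self_nonneg c)
      linarith
    have hpoint (ω : Ω) :
        2 * c * X ω ≤ X ω ^ 2 + {ω | 0 ≤ X ω}.indicator (fun _ ↦ c ^ 2) ω := by
      by_cases hω : 0 ≤ X ω
      · rw [indicator_of_mem (by exact hω)]
        nlinarith [sq_nonneg (X ω - c)]
      · rw [indicator_of_notMem (by exact hω)]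
        nlinarith [sq_nonneg (X ω)]
    have hind : Integrable ({ω | 0 ≤ X ω}.indicator fun _ ↦ c ^ 2) μ :=
      (integrable_const _).indicator₀ hS
    have hint := integral_mono (hX1.const_mul (2 * c)) (hX.integrable_sq.add hind) hpoint
    rw [integral_const_mul, integral_add' hX.integrable_sq hind, integral_indicator₀ hS,
      setIntegral_const, smul_eq_mul] at hint
    simp only [Pi.pow_apply]
    linarith
  have := discrim_le_zero hquad
  rw [discrim] at this
  linarith

lemma sq_div_variance_add_sq_le_measureReal [IsProbabilityMeasure μ] (hX : MemLp X 2 μ) {a : ℝ}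
    (ha : a < μ[X]) :
    (μ[X] - a) ^ 2 / (Var[X; μ] + (μ[X] - a) ^ 2) ≤ μ.real {ω | a ≤ X ω} := by
  have hmem : MemLp (fun ω ↦ X ω - a) 2 μ := hX.sub (memLp_const a)
  have hmean : ∫ ω, X ω - a ∂μ = μ[X] - a := by
    rw [integral_sub (hX.integrable one_le_two) (integrable_const a), integral_const]
    simp
  have hsq : ∫ ω, (X ω - a) ^ 2 ∂μ = Var[X; μ] + (μ[X] - a) ^ 2 := by
    rw [← variance_sub_const hX.aestronglyMeasurable a, variance_eq_sub hmem, hmean]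
    simp
  have hpos : 0 < (μ[X] - a) ^ 2 := pow_pos (sub_pos.2 ha) 2
  rw [div_le_iff₀' (add_pos_of_nonneg_of_pos (variance_nonneg _ _) hpos), ← hsq, ← hmean]
  simpa only [Pi.pow_apply, sub_nonneg] using
    sq_integral_le_integral_sq_mul_measureReal hmem (hmean ▸ (sub_pos.2 ha).le)

end SecondMoment

section Convolution

lemma measureReal_conv_le_add {M : Type*} [AddMonoid M] [MeasurableSpace M] [MeasurableAdd₂ M]
    {μ ν : Measure M} [IsProbabilityMeasure μ] [IsProbabilityMeasure ν] {s : Set M}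
    (hs : MeasurableSet s) : (μ.conv ν).real s ≤ μ.real s + ν.real {0}ᶜ := by
  have hsub : (fun x : M × M ↦ x.1 + x.2) ⁻¹' s ⊆ s ×ˢ univ ∪ univ ×ˢ {0}ᶜ := by
    rintro ⟨u, v⟩ huv
    by_cases hv : v = 0
    · exact Or.inl ⟨by simpa [hv] using huv, mem_univ v⟩
    · exact Or.inr ⟨mem_univ u, hv⟩
  calc (μ.conv ν).real s = (μ.prod ν).real ((fun x : M × M ↦ x.1 + x.2) ⁻¹' s) :=
        map_measureReal_apply measurable_add hs
    _ ≤ (μ.prod ν).real (s ×ˢ univ) + (μ.prod ν).real (univ ×ˢ {0}ᶜ) :=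
        (measureReal_mono hsub).trans (measureReal_union_le _ _)
    _ = μ.real s + ν.real {0}ᶜ := by
        rw [measureReal_prod_prod, measureReal_prod_prod, probReal_univ, probReal_univ, mul_one,
          one_mul]

lemma measureReal_Ici_mul_le_conv {μ ν : Measure ℝ} [IsFiniteMeasure μ] [IsFiniteMeasure ν]
    (a b : ℝ) : μ.real (Ici a) * ν.real (Ici b) ≤ (μ.conv ν).real (Ici (a + b)) := by
  rw [Measure.conv, map_measureReal_apply measurable_add measurableSet_Ici,
    ← measureReal_prod_prod]
  exact measureReal_mono fun x hx ↦ add_le_add (mem_Ici.1 hx.1) (mem_Ici.1 hx.2)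

end Convolution

section CompoundPoisson

/-- The characteristic exponent `∫ (e^{itx} - 1) dν(x)` of the infinitely divisible law without
drift whose jumps have intensity `ν`. -/
noncomputable def levyExponent (ν : Measure ℝ) (t : ℝ) : ℂ :=
  ∫ x, (Complex.exp (Complex.I * t * x) - 1) ∂ν

/-- The number of summands in the `k`-th approximation of the compound Poisson law with jump
intensity `Λ`; it is positive and at least the mass of `Λ`, so that `rareJumpLaw Λ k` is a
probability measure. -/
noncomputable def jumpCount (Λ : Measure ℝ) (k : ℕ) : ℕ := k + ⌈Λ.real univ⌉₊ + 1

/-- The law of one summand of `compoundPoissonApprox Λ k`: with `N = jumpCount Λ k`, a jump occurs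
with intensity `Λ / N`, and the remaining mass is at `0`. -/
noncomputable def rareJumpLaw (Λ : Measure ℝ) (k : ℕ) : Measure ℝ :=
  ENNReal.ofReal (1 - Λ.real univ / jumpCount Λ k) • Measure.dirac 0
    + ENNReal.ofReal (1 / jumpCount Λ k) • Λ

/-- The law of the sum of `jumpCount Λ k` independent variables with law `rareJumpLaw Λ k`. As
`k → ∞` it converges to the compound Poisson law with jump intensity `Λ`. -/
noncomputable def compoundPoissonApprox (Λ : Measure ℝ) (k : ℕ) : Measure ℝ :=
  (Measure.pi fun _ : Fin (jumpCount Λ k) ↦ rareJumpLaw Λ k).map fun x ↦ ∑ i, x i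

variable {Λ : Measure ℝ} {k : ℕ}

lemma jumpCount_pos : (0 : ℝ) < jumpCount Λ k := by
  rw [jumpCount]
  positivity

lemma measureReal_univ_le_jumpCount : Λ.real univ ≤ jumpCount Λ k :=
  (Nat.le_ceil _).trans (by exact_mod_cast (by unfold jumpCount; lia : _ ≤ jumpCount Λ k))

lemma tendsto_jumpCount (Λ : ℕ → Measure ℝ) : Tendsto (fun k ↦ jumpCount (Λ k) k) atTop atTop :=
  tendsto_atTop_mono (fun k ↦ by rw [id, jumpCount]; lia) tendsto_id

lemma one_sub_mass_div_jumpCount_nonneg : 0 ≤ 1 - Λ.real univ / jumpCount Λ k :=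
  sub_nonneg.2 ((div_le_one jumpCount_pos).2 measureReal_univ_le_jumpCount)

lemma memLp_rareJumpLaw (hΛ : MemLp id 2 Λ) : MemLp id 2 (rareJumpLaw Λ k) := by
  rw [memLp_two_iff_integrable_sq (by fun_prop)]
  exact ((integrable_dirac (by finiteness)).smul_measure ENNReal.ofReal_ne_top).add_measure
    (hΛ.integrable_sq.smul_measure ENNReal.ofReal_ne_top)

lemma integral_rareJumpLaw {E : Type*} [NormedAddCommGroup E] [NormedSpace ℝ E] [CompleteSpace E]
    {f : ℝ → E} (hf : Integrable f Λ) :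
    ∫ x, f x ∂rareJumpLaw Λ k
      = (1 - Λ.real univ / jumpCount Λ k) • f 0 + (1 / jumpCount Λ k : ℝ) • ∫ x, f x ∂Λ := by
  rw [rareJumpLaw, integral_add_measure
    ((integrable_dirac (by finiteness)).smul_measure ENNReal.ofReal_ne_top)
    (hf.smul_measure ENNReal.ofReal_ne_top), integral_smul_measure, integral_smul_measure,
    integral_dirac, ENNReal.toReal_ofReal one_sub_mass_div_jumpCount_nonneg,
    ENNReal.toReal_ofReal (by positivity)]

lemma ae_nonneg_rareJumpLaw (h0 : ∀ᵐ x ∂Λ, 0 ≤ x) : ∀ᵐ x ∂rareJumpLaw Λ k, 0 ≤ x := by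
  rw [rareJumpLaw, ae_add_measure_iff]
  exact ⟨Measure.ae_smul_measure ((ae_dirac_iff measurableSet_Ici).2 le_rfl) _,
    Measure.ae_smul_measure h0 _⟩

lemma measureReal_rareJumpLaw_of_zero_notMem {s : Set ℝ} (hs : MeasurableSet s) (h0 : 0 ∉ s) :
    (rareJumpLaw Λ k).real s = Λ.real s / jumpCount Λ k := by
  rw [measureReal_def, rareJumpLaw, Measure.add_apply, Measure.smul_apply, Measure.smul_apply,
    Measure.dirac_apply' _ hs, indicator_of_notMem h0, smul_zero, zero_add, smul_eq_mul,
    ENNReal.toReal_mul, ENNReal.toReal_ofReal (by positivity), ← measureReal_def,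
    one_div_mul_eq_div]

variable [IsFiniteMeasure Λ]

instance : IsProbabilityMeasure (rareJumpLaw Λ k) where
  measure_univ := by
    have hsum : 1 - Λ.real univ / jumpCount Λ k + 1 / jumpCount Λ k * Λ.real univ = 1 := by ring
    rw [rareJumpLaw, Measure.add_apply, Measure.smul_apply, Measure.smul_apply, measure_univ,
      ← ofReal_measureReal, smul_eq_mul, smul_eq_mul, mul_one,
      ← ENNReal.ofReal_mul (by positivity),
      ← ENNReal.ofReal_add one_sub_mass_div_jumpCount_nonneg (by positivity), hsum,
      ENNReal.ofReal_one]

instance : IsProbabilityMeasure (compoundPoissonApprox Λ k) :=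
  Measure.isProbabilityMeasure_map (by fun_prop)

lemma charFun_rareJumpLaw (t : ℝ) :
    charFun (rareJumpLaw Λ k) t = 1 + levyExponent Λ t / jumpCount Λ k := by
  have hint : Integrable (fun x : ℝ ↦ Complex.exp (Complex.I * t * x)) Λ := by
    refine Integrable.of_bound (by fun_prop) 1 (ae_of_all _ fun x ↦ ?_)
    rw [mul_assoc]
    exact_mod_cast (Complex.norm_exp_I_mul_ofReal (t * x)).le
  have hcomm (x : ℝ) : Complex.exp (t * x * Complex.I) = Complex.exp (Complex.I * t * x) := by
    ring_nf
  simp only [charFun_apply_real, hcomm]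
  rw [integral_rareJumpLaw hint, levyExponent, integral_sub hint (integrable_const _)]
  simp only [integral_const, Complex.real_smul, Complex.ofReal_zero, mul_zero, Complex.exp_zero]
  push_cast
  ring

lemma charFun_compoundPoissonApprox (t : ℝ) :
    charFun (compoundPoissonApprox Λ k) t
      = (1 + levyExponent Λ t / jumpCount Λ k) ^ jumpCount Λ k := by
  rw [compoundPoissonApprox, charFun_map_sum_pi_eq_prod, Finset.prod_const, Finset.card_univ,
    Fintype.card_fin, Pi.pow_apply, charFun_rareJumpLaw]

lemma tendsto_charFun_compoundPoissonApprox {Λ : ℕ → Measure ℝ} [∀ k, IsFiniteMeasure (Λ k)]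
    {t : ℝ} {w : ℂ} (h : Tendsto (fun k ↦ levyExponent (Λ k) t) atTop (𝓝 w)) :
    Tendsto (fun k ↦ charFun (compoundPoissonApprox (Λ k) k) t) atTop (𝓝 (Complex.exp w)) := by
  simp only [charFun_compoundPoissonApprox]
  exact tendsto_one_add_div_pow_exp_of_tendsto (tendsto_jumpCount Λ) h

lemma memLp_compoundPoissonApprox (hΛ : MemLp id 2 Λ) :
    MemLp id 2 (compoundPoissonApprox Λ k) := by
  rw [compoundPoissonApprox, memLp_map_measure_iff (by fun_prop) (by fun_prop)]
  exact memLp_finsetSum Finset.univ fun i _ ↦ (memLp_rareJumpLaw hΛ).comp_measurePreserving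
    (measurePreserving_eval (fun _ : Fin (jumpCount Λ k) ↦ rareJumpLaw Λ k) i)

lemma integral_id_compoundPoissonApprox (hΛ : MemLp id 2 Λ) :
    ∫ x, id x ∂compoundPoissonApprox Λ k = ∫ x, x ∂Λ := by
  have hint : Integrable id (rareJumpLaw Λ k) := (memLp_rareJumpLaw hΛ).integrable one_le_two
  have hsingle (i : Fin (jumpCount Λ k)) :
      ∫ x, id (x i) ∂(Measure.pi fun _ : Fin (jumpCount Λ k) ↦ rareJumpLaw Λ k)
        = (∫ x, x ∂Λ) / jumpCount Λ k := by
    rw [integral_comp_eval (μ := fun _ ↦ rareJumpLaw Λ k) hint.aestronglyMeasurable,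
      integral_rareJumpLaw (hΛ.integrable one_le_two)]
    simp [div_eq_inv_mul]
  rw [compoundPoissonApprox, integral_map (by fun_prop) (by fun_prop)]
  change ∫ x, ∑ i, id (x i) ∂(Measure.pi fun _ : Fin (jumpCount Λ k) ↦ rareJumpLaw Λ k) = _
  rw [integral_finsetSum _ fun i _ ↦ integrable_comp_eval (μ := fun _ ↦ rareJumpLaw Λ k) hint]
  simp only [hsingle, Finset.sum_const, Finset.card_univ, Fintype.card_fin, nsmul_eq_mul]
  exact mul_div_cancel₀ _ jumpCount_pos.ne'

lemma variance_compoundPoissonApprox_le (hΛ : MemLp id 2 Λ) :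
    Var[id; compoundPoissonApprox Λ k] ≤ ∫ x, x ^ 2 ∂Λ := by
  have hsum : (id ∘ fun x : Fin (jumpCount Λ k) → ℝ ↦ ∑ i, x i)
      = ∑ i, fun x : Fin (jumpCount Λ k) → ℝ ↦ id (x i) := by
    ext x
    simp
  have hsingle : Var[id; rareJumpLaw Λ k] ≤ (∫ x, x ^ 2 ∂Λ) / jumpCount Λ k := by
    refine (variance_le_expectation_sq (by fun_prop)).trans_eq ?_
    simp only [Pi.pow_apply]
    rw [integral_rareJumpLaw hΛ.integrable_sq]
    simp [div_eq_inv_mul]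
  rw [compoundPoissonApprox, variance_map (by fun_prop) (by fun_prop), hsum,
    variance_sum_pi fun _ ↦ memLp_rareJumpLaw hΛ, Finset.sum_const, Finset.card_univ,
    Fintype.card_fin, nsmul_eq_mul]
  exact (le_div_iff₀' jumpCount_pos).1 hsingle

lemma measureReal_Ioi_compoundPoissonApprox_le (hΛ : MemLp id 2 Λ) {s : ℝ} (hs : 0 < s) :
    (compoundPoissonApprox Λ k).real (Ioi (∫ x, x ∂Λ + s)) ≤ (∫ x, x ^ 2 ∂Λ) / s ^ 2 := by
  have hcheb := meas_ge_le_variance_div_sq (memLp_compoundPoissonApprox (k := k) hΛ) hs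
  rw [integral_id_compoundPoissonApprox hΛ] at hcheb
  have hsub : Ioi (∫ x, x ∂Λ + s) ⊆ {x | s ≤ |id x - ∫ x, x ∂Λ|} := fun x hx ↦
    (le_sub_iff_add_le'.2 (mem_Ioi.1 hx).le).trans (le_abs_self _)
  calc (compoundPoissonApprox Λ k).real (Ioi (∫ x, x ∂Λ + s))
      ≤ Var[id; compoundPoissonApprox Λ k] / s ^ 2 :=
        ENNReal.toReal_le_of_le_ofReal (div_nonneg (variance_nonneg _ _) (sq_nonneg s))
          ((measure_mono hsub).trans hcheb)
    _ ≤ (∫ x, x ^ 2 ∂Λ) / s ^ 2 := by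
        gcongr
        exact variance_compoundPoissonApprox_le hΛ

lemma le_measureReal_Ici_compoundPoissonApprox (hΛ : MemLp id 2 Λ) {a : ℝ} (ha : a < ∫ x, x ∂Λ) :
    (∫ x, x ∂Λ - a) ^ 2 / (∫ x, x ^ 2 ∂Λ + (∫ x, x ∂Λ - a) ^ 2)
      ≤ (compoundPoissonApprox Λ k).real (Ici a) := by
  have hmean := integral_id_compoundPoissonApprox (k := k) hΛ
  have hcant := sq_div_variance_add_sq_le_measureReal (memLp_compoundPoissonApprox (k := k) hΛ)
    (hmean ▸ ha)
  rw [hmean] at hcant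
  have hpos : 0 < (∫ x, x ∂Λ - a) ^ 2 := pow_pos (sub_pos.2 ha) 2
  refine le_trans ?_ hcant
  gcongr
  · exact add_pos_of_nonneg_of_pos (variance_nonneg _ _) hpos
  · exact variance_compoundPoissonApprox_le hΛ

lemma measureReal_compl_zero_compoundPoissonApprox_le :
    (compoundPoissonApprox Λ k).real {0}ᶜ ≤ Λ.real univ := by
  have hsub : (fun x : Fin (jumpCount Λ k) → ℝ ↦ ∑ i, x i) ⁻¹' {0}ᶜ
      ⊆ ⋃ i, Function.eval i ⁻¹' {0}ᶜ := by
    intro x hx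
    obtain ⟨i, -, hi⟩ := Finset.exists_ne_zero_of_sum_ne_zero hx
    exact mem_iUnion.2 ⟨i, hi⟩
  have hsingle (i : Fin (jumpCount Λ k)) :
      (Measure.pi fun _ : Fin (jumpCount Λ k) ↦ rareJumpLaw Λ k).real (Function.eval i ⁻¹' {0}ᶜ)
        ≤ Λ.real univ / jumpCount Λ k := by
    have h0 : MeasurableSet ({0}ᶜ : Set ℝ) := (measurableSet_singleton 0).compl
    rw [(measurePreserving_eval (fun _ ↦ rareJumpLaw Λ k) i).measureReal_preimage
      h0.nullMeasurableSet, measureReal_rareJumpLaw_of_zero_notMem h0 (by simp)]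
    gcongr
    · finiteness
    · exact subset_univ _
  rw [compoundPoissonApprox,
    map_measureReal_apply (by fun_prop) (measurableSet_singleton 0).compl]
  refine ((measureReal_mono hsub).trans (measureReal_iUnion_fintype_le _)).trans ?_
  refine (Finset.sum_le_card_nsmul _ _ _ fun i _ ↦ hsingle i).trans_eq ?_
  rw [Finset.card_univ, Fintype.card_fin, nsmul_eq_mul, mul_div_cancel₀ _ jumpCount_pos.ne']

/-- A sum of nonnegative jumps exceeds `y` as soon as one of them does. -/
lemma one_sub_exp_le_measureReal_Ici_compoundPoissonApprox (h0 : ∀ᵐ x ∂Λ, 0 ≤ x) {y : ℝ}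
    (hy : 0 < y) : 1 - Real.exp (-Λ.real (Ici y)) ≤ (compoundPoissonApprox Λ k).real (Ici y) := by
  have hsingle : (rareJumpLaw Λ k).real (Iio y) = 1 - Λ.real (Ici y) / jumpCount Λ k := by
    rw [← compl_Ici, probReal_compl_eq_one_sub measurableSet_Ici,
      measureReal_rareJumpLaw_of_zero_notMem measurableSet_Ici (notMem_Ici.2 hy)]
  have hnonneg : ∀ᵐ x ∂(Measure.pi fun _ : Fin (jumpCount Λ k) ↦ rareJumpLaw Λ k),
      ∀ i, 0 ≤ x i := ae_all_iff.2 fun i ↦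
    (measurePreserving_eval (fun _ ↦ rareJumpLaw Λ k) i).quasiMeasurePreserving.ae
      (ae_nonneg_rareJumpLaw h0)
  have hle : (compoundPoissonApprox Λ k).real (Iio y) ≤ Real.exp (-Λ.real (Ici y)) := by
    rw [compoundPoissonApprox, map_measureReal_apply (by fun_prop) measurableSet_Iio]
    calc (Measure.pi fun _ : Fin (jumpCount Λ k) ↦ rareJumpLaw Λ k).real
            ((fun x ↦ ∑ i, x i) ⁻¹' Iio y)
        ≤ (Measure.pi fun _ ↦ rareJumpLaw Λ k).real (univ.pi fun _ ↦ Iio y) := by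
          refine ENNReal.toReal_mono (by finiteness) (measure_mono_ae ?_)
          filter_upwards [hnonneg] with x hx hsum i _
          exact (Finset.single_le_sum (fun j _ ↦ hx j) (Finset.mem_univ i)).trans_lt hsum
      _ = (1 - Λ.real (Ici y) / jumpCount Λ k) ^ jumpCount Λ k := by
          rw [measureReal_def, Measure.pi_pi, Finset.prod_const, Finset.card_univ,
            Fintype.card_fin, ENNReal.toReal_pow, ← measureReal_def, hsingle]
      _ ≤ Real.exp (-Λ.real (Ici y)) := Real.one_sub_div_pow_le_exp_neg
          ((measureReal_mono (subset_univ _)).trans measureReal_univ_le_jumpCount)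
  rw [← compl_Ici, probReal_compl_eq_one_sub measurableSet_Ici] at hle
  linarith

end CompoundPoisson

section LevyMeasure

/-- `ν` is the Lévy measure of a subordinator: it lives on `(0, ∞)` and integrates `min x 1`.
Finiteness away from `0` and integrability of small jumps are both encoded by the latter. -/
structure IsSubordinatorLevyMeasure (ν : Measure ℝ) : Prop where
  ae_pos : ∀ᵐ x ∂ν, 0 < x
  integrable_min_one : Integrable (fun x ↦ min x 1) ν

/-- The approximation of the infinitely divisible law with Lévy measure `ν` in which the jumps of
size in `[1 / (k + 1), R)` and those of size at least `R` are approximated independently, and the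
smaller ones are discarded. -/
noncomputable def levyApprox (ν : Measure ℝ) (R : ℝ) (k : ℕ) : Measure ℝ :=
  (compoundPoissonApprox (ν.restrict (Ico (1 / (k + 1)) R)) k).conv
    (compoundPoissonApprox (ν.restrict (Ici R)) k)

namespace IsSubordinatorLevyMeasure

variable {ν : Measure ℝ}

lemma isFiniteMeasure_restrict (hν : IsSubordinatorLevyMeasure ν) {s : Set ℝ} {c : ℝ}
    (hc : 0 < c) (hs : s ⊆ Ici c) :
    IsFiniteMeasure (ν.restrict s) := by
  have hsub : s ⊆ {x : ℝ | min c 1 ≤ ‖min x 1‖} := fun x hx ↦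
    (min_le_min_right (1 : ℝ) (hs hx)).trans (Real.le_norm_self _)
  exact MeasureTheory.isFiniteMeasure_restrict.2 (ne_top_of_le_ne_top
    (hν.integrable_min_one.measure_norm_ge_lt_top (lt_min hc zero_lt_one)).ne (measure_mono hsub))

lemma isFiniteMeasure_restrict_Ico (hν : IsSubordinatorLevyMeasure ν) (k : ℕ) (R : ℝ) :
    IsFiniteMeasure (ν.restrict (Ico (1 / (k + 1)) R)) :=
  hν.isFiniteMeasure_restrict Nat.one_div_pos_of_nat Ico_subset_Ici_self

lemma integrable_exp_sub_one (hν : IsSubordinatorLevyMeasure ν) (t : ℝ) :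
    Integrable (fun x : ℝ ↦ Complex.exp (Complex.I * t * x) - 1) ν := by
  refine (hν.integrable_min_one.const_mul (|t| + 2)).mono' (by fun_prop) ?_
  filter_upwards [hν.ae_pos] with x hx
  have hcast : Complex.I * t * x = Complex.I * (t * x : ℝ) := by
    push_cast
    ring
  rw [hcast]
  rcases le_total x 1 with hx1 | hx1
  · calc ‖Complex.exp (Complex.I * (t * x : ℝ)) - 1‖ ≤ ‖t * x‖ :=
          Real.norm_exp_I_mul_ofReal_sub_one_le
      _ = |t| * x := by rw [norm_mul, Real.norm_eq_abs, Real.norm_of_nonneg hx.le]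
      _ ≤ (|t| + 2) * min x 1 := by rw [min_eq_left hx1]; linarith
  · calc ‖Complex.exp (Complex.I * (t * x : ℝ)) - 1‖ ≤ 1 + 1 := by
          refine (norm_sub_le _ _).trans_eq ?_
          rw [Complex.norm_exp_I_mul_ofReal, norm_one]
      _ ≤ (|t| + 2) * min x 1 := by rw [min_eq_right hx1]; linarith [abs_nonneg t]

lemma integrableOn_pow_Iio (hν : IsSubordinatorLevyMeasure ν) {p : ℕ} (hp : p ≠ 0) (R : ℝ) :
    IntegrableOn (fun x ↦ x ^ p) (Iio R) ν := by
  refine (hν.integrable_min_one.const_mul (1 + |R| ^ p)).integrableOn.mono' (by fun_prop) ?_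
  filter_upwards [ae_restrict_of_ae hν.ae_pos, ae_restrict_mem measurableSet_Iio] with x hx hxR
  have hRp : 0 ≤ |R| ^ p := by positivity
  rw [Real.norm_of_nonneg (by positivity)]
  rcases le_total x 1 with hx1 | hx1
  · rw [min_eq_left hx1]
    nlinarith [pow_le_of_le_one hx.le hx1 hp]
  · rw [min_eq_right hx1]
    linarith [pow_le_pow_left₀ hx.le ((mem_Iio.1 hxR).le.trans (le_abs_self R)) p]

lemma memLp_id_restrict_Ico (hν : IsSubordinatorLevyMeasure ν) (k : ℕ) (R : ℝ) :
    MemLp id 2 (ν.restrict (Ico (1 / (k + 1)) R)) :=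
  (memLp_two_iff_integrable_sq (by fun_prop)).2
    ((hν.integrableOn_pow_Iio two_ne_zero R).mono_set Ico_subset_Iio_self)

lemma setIntegral_pow_Ico_le_Iio (hν : IsSubordinatorLevyMeasure ν) {p : ℕ} (hp : p ≠ 0)
    (k : ℕ) (R : ℝ) :
    ∫ x in Ico (1 / (k + 1)) R, x ^ p ∂ν ≤ ∫ x in Iio R, x ^ p ∂ν :=
  setIntegral_mono_set (hν.integrableOn_pow_Iio hp R)
    ((ae_restrict_of_ae hν.ae_pos).mono fun _ hx ↦ pow_nonneg hx.le p)
    Ico_subset_Iio_self.eventuallyLE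

lemma tendsto_setIntegral_Ico (hν : IsSubordinatorLevyMeasure ν) {E : Type*}
    [NormedAddCommGroup E] [NormedSpace ℝ E] {f : ℝ → E} {R : ℝ} (hf : IntegrableOn f (Iio R) ν) :
    Tendsto (fun k : ℕ ↦ ∫ x in Ico (1 / (k + 1)) R, f x ∂ν) atTop
      (𝓝 (∫ x in Iio R, f x ∂ν)) := by
  have hcover : AECover (ν.restrict (Iio R)) atTop fun k : ℕ ↦ Ici (1 / (k + 1) : ℝ) := by
    refine ⟨(ae_restrict_of_ae hν.ae_pos).mono fun x hx ↦ ?_, fun _ ↦ measurableSet_Ici⟩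
    exact tendsto_one_div_add_atTop_nhds_zero_nat.eventually_le_const hx
  refine (hcover.integral_tendsto_of_countably_generated hf).congr fun k ↦ ?_
  rw [Measure.restrict_restrict measurableSet_Ici, Ici_inter_Iio]

lemma tendsto_levyExponent_Ico (hν : IsSubordinatorLevyMeasure ν) (R t : ℝ) :
    Tendsto (fun k : ℕ ↦ levyExponent (ν.restrict (Ico (1 / (k + 1)) R)) t) atTop
      (𝓝 (levyExponent (ν.restrict (Iio R)) t)) :=
  hν.tendsto_setIntegral_Ico (hν.integrable_exp_sub_one t).integrableOn

lemma levyExponent_restrict_add (hν : IsSubordinatorLevyMeasure ν) (R t : ℝ) :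
    levyExponent (ν.restrict (Iio R)) t + levyExponent (ν.restrict (Ici R)) t
      = levyExponent ν t := by
  rw [← compl_Iio]
  exact integral_add_compl measurableSet_Iio (hν.integrable_exp_sub_one t)

variable {R : ℝ}

lemma isProbabilityMeasure_levyApprox (hν : IsSubordinatorLevyMeasure ν) (hR : 0 < R) (k : ℕ) :
    IsProbabilityMeasure (levyApprox ν R k) := by
  have := hν.isFiniteMeasure_restrict_Ico k R
  have := hν.isFiniteMeasure_restrict hR subset_rfl
  unfold levyApprox
  infer_instance

lemma tendsto_charFun_levyApprox (hν : IsSubordinatorLevyMeasure ν) (hR : 0 < R) (t : ℝ) :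
    Tendsto (fun k ↦ charFun (levyApprox ν R k) t) atTop (𝓝 (Complex.exp (levyExponent ν t))) := by
  have hsmall := hν.isFiniteMeasure_restrict_Ico (R := R)
  have hlarge := hν.isFiniteMeasure_restrict hR subset_rfl
  simp only [levyApprox, charFun_conv]
  rw [← hν.levyExponent_restrict_add R, Complex.exp_add]
  exact (tendsto_charFun_compoundPoissonApprox (hν.tendsto_levyExponent_Ico R t)).mul
    (tendsto_charFun_compoundPoissonApprox tendsto_const_nhds)

lemma measureReal_Ioi_levyApprox_le (hν : IsSubordinatorLevyMeasure ν) (hR : 0 < R) {s : ℝ}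
    (hs : 0 < s) (k : ℕ) :
    (levyApprox ν R k).real (Ioi (∫ x in Iio R, x ∂ν + s))
      ≤ (∫ x in Iio R, x ^ 2 ∂ν) / s ^ 2 + ν.real (Ici R) := by
  have := hν.isFiniteMeasure_restrict_Ico k R
  have := hν.isFiniteMeasure_restrict hR subset_rfl
  have hmean : ∫ x in Ico (1 / (k + 1)) R, x ∂ν ≤ ∫ x in Iio R, x ∂ν := by
    simpa only [pow_one] using hν.setIntegral_pow_Ico_le_Iio one_ne_zero k R
  refine (measureReal_conv_le_add measurableSet_Ioi).trans (add_le_add ?_ ?_)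
  · calc (compoundPoissonApprox (ν.restrict (Ico (1 / (k + 1)) R)) k).real
          (Ioi (∫ x in Iio R, x ∂ν + s))
        ≤ (compoundPoissonApprox (ν.restrict (Ico (1 / (k + 1)) R)) k).real
            (Ioi (∫ x in Ico (1 / (k + 1)) R, x ∂ν + s)) :=
          measureReal_mono (Ioi_subset_Ioi (by gcongr))
      _ ≤ (∫ x in Ico (1 / (k + 1)) R, x ^ 2 ∂ν) / s ^ 2 :=
          measureReal_Ioi_compoundPoissonApprox_le (hν.memLp_id_restrict_Ico k R) hs
      _ ≤ (∫ x in Iio R, x ^ 2 ∂ν) / s ^ 2 :=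
          div_le_div_of_nonneg_right (hν.setIntegral_pow_Ico_le_Iio two_ne_zero k R) (sq_nonneg s)
  · rw [← measureReal_restrict_apply_univ (Ici R)]
    exact measureReal_compl_zero_compoundPoissonApprox_le

lemma le_measureReal_Ici_levyApprox (hν : IsSubordinatorLevyMeasure ν) (hR : 0 < R) {a y : ℝ}
    {k : ℕ} (ha : a < ∫ x in Ico (1 / (k + 1)) R, x ∂ν) (hRy : R ≤ y) :
    (∫ x in Ico (1 / (k + 1)) R, x ∂ν - a) ^ 2
        / (∫ x in Ico (1 / (k + 1)) R, x ^ 2 ∂ν + (∫ x in Ico (1 / (k + 1)) R, x ∂ν - a) ^ 2)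
        * (1 - Real.exp (-ν.real (Ici y)))
      ≤ (levyApprox ν R k).real (Ici (a + y)) := by
  have := hν.isFiniteMeasure_restrict_Ico k R
  have := hν.isFiniteMeasure_restrict hR subset_rfl
  have hlarge := one_sub_exp_le_measureReal_Ici_compoundPoissonApprox (k := k)
    (ae_restrict_of_ae (s := Ici R) (hν.ae_pos.mono fun _ ↦ le_of_lt)) (hR.trans_le hRy)
  rw [measureReal_restrict_apply measurableSet_Ici,
    inter_eq_left.2 (Ici_subset_Ici.2 hRy)] at hlarge
  refine (mul_le_mul ?_ hlarge ?_ measureReal_nonneg).trans (measureReal_Ici_mul_le_conv a y)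
  · exact le_measureReal_Ici_compoundPoissonApprox (hν.memLp_id_restrict_Ico k R) ha
  · exact sub_nonneg.2 (Real.exp_le_one_iff.2 (neg_nonpos.2 measureReal_nonneg))

variable {μ : Measure ℝ} [IsProbabilityMeasure μ]

theorem measureReal_Ioi_le (hν : IsSubordinatorLevyMeasure ν) (hR : 0 < R)
    (hμ : ∀ t, charFun μ t = Complex.exp (levyExponent ν t)) {s : ℝ} (hs : 0 < s) :
    μ.real (Ioi (∫ x in Iio R, x ∂ν + s))
      ≤ (∫ x in Iio R, x ^ 2 ∂ν) / s ^ 2 + ν.real (Ici R) := by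
  have := hν.isProbabilityMeasure_levyApprox hR
  exact measureReal_le_of_tendsto_charFun (μs := levyApprox ν R)
    (fun t ↦ hμ t ▸ hν.tendsto_charFun_levyApprox hR t) isOpen_Ioi
    (hν.measureReal_Ioi_levyApprox_le hR hs)

theorem le_measureReal_Ici (hν : IsSubordinatorLevyMeasure ν) (hR : 0 < R)
    (hμ : ∀ t, charFun μ t = Complex.exp (levyExponent ν t)) {a y : ℝ}
    (ha : a < ∫ x in Iio R, x ∂ν) (hRy : R ≤ y) :
    (∫ x in Iio R, x ∂ν - a) ^ 2
        / (∫ x in Iio R, x ^ 2 ∂ν + (∫ x in Iio R, x ∂ν - a) ^ 2)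
        * (1 - Real.exp (-ν.real (Ici y)))
      ≤ μ.real (Ici (a + y)) := by
  have := hν.isProbabilityMeasure_levyApprox hR
  have hmean : Tendsto (fun k : ℕ ↦ ∫ x in Ico (1 / (k + 1)) R, x ∂ν) atTop
      (𝓝 (∫ x in Iio R, x ∂ν)) :=
    hν.tendsto_setIntegral_Ico (by simpa using hν.integrableOn_pow_Iio one_ne_zero R)
  have hsq : Tendsto (fun k : ℕ ↦ ∫ x in Ico (1 / (k + 1)) R, x ^ 2 ∂ν) atTop
      (𝓝 (∫ x in Iio R, x ^ 2 ∂ν)) :=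
    hν.tendsto_setIntegral_Ico (hν.integrableOn_pow_Iio two_ne_zero R)
  have hgap := (hmean.sub_const a).pow 2
  have hpos : 0 < ∫ x in Iio R, x ^ 2 ∂ν + (∫ x in Iio R, x ∂ν - a) ^ 2 :=
    add_pos_of_nonneg_of_pos (integral_nonneg fun x ↦ sq_nonneg x) (pow_pos (sub_pos.2 ha) 2)
  exact le_measureReal_of_tendsto_charFun (μs := levyApprox ν R)
    (fun t ↦ hμ t ▸ hν.tendsto_charFun_levyApprox hR t) isClosed_Ici
    ((hgap.div (hsq.add hgap) hpos.ne').mul_const _)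
    ((hmean.eventually_const_lt ha).mono fun k hk ↦ hν.le_measureReal_Ici_levyApprox hR hk hRy)

end IsSubordinatorLevyMeasure

end LevyMeasure

section StableLaw

/-- The Lévy measure `x^{-α-1} dx` on `(0, ∞)` of the totally asymmetric `α`-stable law. -/
noncomputable def stableLevyMeasure (α : ℝ) : Measure ℝ :=
  (volume.restrict (Ioi 0)).withDensity fun x ↦ ENNReal.ofReal (1 / x ^ (α + 1))

lemma ae_pos_stableLevyMeasure (α : ℝ) : ∀ᵐ x ∂stableLevyMeasure α, 0 < x :=
  (withDensity_absolutelyContinuous _ _).ae_le (ae_restrict_mem measurableSet_Ioi)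

lemma setIntegral_stableLevyMeasure {E : Type*} [NormedAddCommGroup E] [NormedSpace ℝ E]
    (α : ℝ) {s : Set ℝ} (hs : MeasurableSet s) (f : ℝ → E) :
    ∫ x in s, f x ∂stableLevyMeasure α = ∫ x in s ∩ Ioi 0, (1 / x ^ (α + 1)) • f x := by
  rw [stableLevyMeasure, setIntegral_withDensity_eq_setIntegral_toReal_smul (by fun_prop)
    (ae_of_all _ fun _ ↦ ENNReal.ofReal_lt_top) _ hs, Measure.restrict_restrict hs]
  refine setIntegral_congr_fun (hs.inter measurableSet_Ioi) fun x hx ↦ ?_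
  have hx0 : 0 < x := hx.2
  rw [ENNReal.toReal_ofReal (by positivity)]

lemma levyExponent_stableLevyMeasure (α t : ℝ) :
    levyExponent (stableLevyMeasure α) t = stableExponent α t := by
  rw [levyExponent, ← setIntegral_univ (μ := stableLevyMeasure α),
    setIntegral_stableLevyMeasure α MeasurableSet.univ, univ_inter, stableExponent]
  simp only [Complex.real_smul, mul_comm]

variable {α : ℝ}

lemma isSubordinatorLevyMeasure_stableLevyMeasure (hα : α ∈ Ioo 0 1) :
    IsSubordinatorLevyMeasure (stableLevyMeasure α) := by
  refine ⟨ae_pos_stableLevyMeasure α, ?_⟩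
  rw [stableLevyMeasure, integrable_withDensity_iff_integrable_smul₀' (by fun_prop)
    (ae_of_all _ fun _ ↦ ENNReal.ofReal_lt_top)]
  change IntegrableOn (fun x : ℝ ↦ (ENNReal.ofReal (1 / x ^ (α + 1))).toReal • min x 1) (Ioi 0)
  rw [← Ioc_union_Ioi_eq_Ioi zero_le_one]
  refine IntegrableOn.union ?_ ?_
  · have hint : IntegrableOn (fun x : ℝ ↦ x ^ (-α)) (Ioc 0 1) :=
      (intervalIntegrable_iff_integrableOn_Ioc_of_le zero_le_one).1
        (intervalIntegral.intervalIntegrable_rpow' (by linarith [hα.2]))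
    refine hint.congr_fun (fun x hx ↦ ?_) measurableSet_Ioc
    have hx0 : 0 < x := hx.1
    beta_reduce
    rw [ENNReal.toReal_ofReal (by positivity), min_eq_left hx.2, smul_eq_mul, Real.rpow_neg hx0.le,
      Real.rpow_add_one hx0.ne']
    field_simp
  · refine (integrableOn_Ioi_rpow_of_lt (a := -(α + 1)) (by linarith [hα.1])
      zero_lt_one).congr_fun (fun x hx ↦ ?_) measurableSet_Ioi
    have hx0 : 0 < x := zero_lt_one.trans hx
    beta_reduce
    rw [ENNReal.toReal_ofReal (by positivity), min_eq_right (mem_Ioi.1 hx).le, smul_eq_mul,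
      mul_one, Real.rpow_neg hx0.le, one_div]

lemma setIntegral_Iio_pow_stableLevyMeasure {p : ℕ} (hp : α < p) {R : ℝ} (hR : 0 ≤ R) :
    ∫ x in Iio R, x ^ p ∂stableLevyMeasure α = R ^ (p - α) / (p - α) := by
  have hdensity : EqOn (fun x : ℝ ↦ (1 / x ^ (α + 1)) • x ^ p) (fun x ↦ x ^ (p - α - 1))
      (Ioo 0 R) := fun x hx ↦ by
    beta_reduce
    rw [sub_sub, Real.rpow_sub hx.1, Real.rpow_natCast, smul_eq_mul, one_div_mul_eq_div]
  rw [setIntegral_stableLevyMeasure α measurableSet_Iio, inter_comm, Ioi_inter_Iio,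
    setIntegral_congr_fun measurableSet_Ioo hdensity, ← integral_Ioc_eq_integral_Ioo,
    ← intervalIntegral.integral_of_le hR, integral_rpow (Or.inl (by linarith)), sub_add_cancel,
    Real.zero_rpow (sub_pos.2 hp).ne', sub_zero]

lemma measureReal_Ici_stableLevyMeasure (hα : 0 < α) {y : ℝ} (hy : 0 < y) :
    (stableLevyMeasure α).real (Ici y) = 1 / (α * y ^ α) := by
  have hdensity : EqOn (fun x : ℝ ↦ (1 / x ^ (α + 1)) • (1 : ℝ)) (fun x ↦ x ^ (-(α + 1)))
      (Ici y) := fun x hx ↦ by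
    beta_reduce
    rw [Real.rpow_neg (hy.trans_le hx).le, smul_eq_mul, mul_one, one_div]
  calc (stableLevyMeasure α).real (Ici y) = ∫ x in Ici y, 1 ∂stableLevyMeasure α := by
        rw [setIntegral_const, smul_eq_mul, mul_one]
    _ = ∫ x in Ioi y, x ^ (-(α + 1)) := by
        rw [setIntegral_stableLevyMeasure α measurableSet_Ici,
          inter_eq_left.2 (Ici_subset_Ioi.2 hy),
          setIntegral_congr_fun measurableSet_Ici hdensity, integral_Ici_eq_integral_Ioi]
    _ = 1 / (α * y ^ α) := by
        rw [integral_Ioi_rpow_of_lt (by linarith) hy, neg_add, neg_add_cancel_right,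
          Real.rpow_neg hy.le]
        field_simp

lemma rpow_one_sub_div_le (hα : α ∈ Ioo 0 1) {y : ℝ} (hy : 0 ≤ y) :
    y ^ (1 - α) / (1 - α) ≤ 1 / (1 - α) + y := by
  have h1 : 0 < 1 - α := sub_pos.2 hα.2
  have hbernoulli : y ^ (1 - α) ≤ 1 + (1 - α) * (y - 1) := by
    simpa only [add_sub_cancel] using rpow_one_add_le_one_add_mul_self (s := y - 1)
      (by linarith) h1.le (by linarith [hα.1])
  rw [div_add' _ _ _ h1.ne']
  gcongr
  nlinarith

lemma one_div_one_add_le_one_sub_exp_neg {w : ℝ} (hw : 0 < w) :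
    1 / (1 + w) ≤ 1 - Real.exp (-(1 / w)) := by
  have hexp : Real.exp (-(1 / w)) ≤ (1 / w + 1)⁻¹ := by
    rw [Real.exp_neg]
    exact inv_anti₀ (by positivity) (Real.add_one_le_exp _)
  have heq : 1 / (1 + w) = 1 - (1 / w + 1)⁻¹ := by
    field_simp
    ring
  linarith

lemma two_thirds_mul_sq_le (hα : α ∈ Ioo 0 1) {θ : ℝ} (hθ : θ ∈ Ico 0 1) :
    2 / 3 * (1 - θ) ^ 2
      ≤ (1 / (1 - α) - θ / (1 - α)) ^ 2
        / (1 / (2 - α) + (1 / (1 - α) - θ / (1 - α)) ^ 2) := by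
  have h1 : 0 < 1 - α := sub_pos.2 hα.2
  have h2 : 0 < 2 - α := by linarith
  have hθ1 : 0 < 1 - θ := sub_pos.2 hθ.2
  have hvar : 1 / (2 - α) ≤ 1 / 2 * (1 / (1 - α)) ^ 2 := by
    rw [div_pow, one_pow, ← mul_div_assoc, div_le_div_iff₀ h2 (by positivity)]
    nlinarith [hα.1, hα.2]
  have hθsq : (1 - θ) ^ 2 ≤ 1 := pow_le_one₀ hθ1.le (by linarith [hθ.1])
  rw [← sub_div, le_div_iff₀ (by positivity), div_eq_mul_one_div (1 - θ), mul_pow]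
  set m := (1 / (1 - α)) ^ 2
  have : 0 ≤ m := sq_nonneg _
  calc 2 / 3 * (1 - θ) ^ 2 * (1 / (2 - α) + (1 - θ) ^ 2 * m)
      ≤ 2 / 3 * (1 - θ) ^ 2 * (1 / 2 * m + 1 * m) := by gcongr
    _ = (1 - θ) ^ 2 * m := by ring

namespace IsTotallyAsymmetricStable

variable {Ω : Type*} [MeasurableSpace Ω] {P : Measure Ω} {X : Ω → ℝ}

lemma charFun_map (hX : IsTotallyAsymmetricStable α X P) (t : ℝ) :
    charFun (P.map X) t = Complex.exp (levyExponent (stableLevyMeasure α) t) := by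
  rw [hX.charFun_eq, levyExponent_stableLevyMeasure]

variable [IsProbabilityMeasure P]

theorem measureReal_gt_le (hX : IsTotallyAsymmetricStable α X P) (hα : α ∈ Ioo 0 1) {y : ℝ}
    (hy : 0 < y) : P.real {ω | X ω > 1 / (1 - α) + 3 * y} ≤ 2 / (α * y ^ α) := by
  have := Measure.isProbabilityMeasure_map hX.aemeasurable
  have hα0 := hα.1
  have h2 : 0 < 2 - α := by linarith [hα.2]
  have hmean : ∫ x in Iio y, x ∂stableLevyMeasure α = y ^ (1 - α) / (1 - α) := by
    simpa using setIntegral_Iio_pow_stableLevyMeasure (p := 1) (by simpa using hα.2) hy.le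
  have hsq : ∫ x in Iio y, x ^ 2 ∂stableLevyMeasure α = y ^ (2 - α) / (2 - α) := by
    simpa using setIntegral_Iio_pow_stableLevyMeasure (p := 2) (by simpa using h2) hy.le
  have htail := (isSubordinatorLevyMeasure_stableLevyMeasure hα).measureReal_Ioi_le hy
    hX.charFun_map (mul_pos two_pos hy)
  rw [hmean, hsq, measureReal_Ici_stableLevyMeasure hα0 hy,
    map_measureReal_apply_of_aemeasurable hX.aemeasurable measurableSet_Ioi] at htail
  have hsub : {ω | X ω > 1 / (1 - α) + 3 * y}
      ⊆ X ⁻¹' Ioi (y ^ (1 - α) / (1 - α) + 2 * y) := fun ω (hω : _ < X ω) ↦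
    lt_of_le_of_lt (by linarith [rpow_one_sub_div_le hα hy.le]) hω
  calc P.real {ω | X ω > 1 / (1 - α) + 3 * y}
      ≤ P.real (X ⁻¹' Ioi (y ^ (1 - α) / (1 - α) + 2 * y)) := measureReal_mono hsub
    _ ≤ y ^ (2 - α) / (2 - α) / (2 * y) ^ 2 + 1 / (α * y ^ α) := htail
    _ = 1 / (4 * (2 - α) * y ^ α) + 1 / (α * y ^ α) := by
        rw [Real.rpow_sub hy, Real.rpow_two]
        field_simp
        ring
    _ ≤ 1 / (α * y ^ α) + 1 / (α * y ^ α) := by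
        gcongr
        linarith [hα.2]
    _ = 2 / (α * y ^ α) := by ring

theorem le_measureReal_ge (hX : IsTotallyAsymmetricStable α X P) (hα : α ∈ Ioo 0 1) {y θ : ℝ}
    (hy : 1 ≤ y) (hθ : θ ∈ Ico 0 1) :
    2 / 3 * (1 - θ) ^ 2 * (1 / (1 + α * y ^ α)) ≤ P.real {ω | X ω ≥ θ / (1 - α) + y} := by
  have := Measure.isProbabilityMeasure_map hX.aemeasurable
  have hα0 := hα.1
  have hy0 : 0 < y := zero_lt_one.trans_le hy
  have h1 : 0 < 1 - α := sub_pos.2 hα.2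
  have hmean : ∫ x in Iio 1, x ∂stableLevyMeasure α = 1 / (1 - α) := by
    simpa using setIntegral_Iio_pow_stableLevyMeasure (p := 1) (by simpa using hα.2) zero_le_one
  have hsq : ∫ x in Iio 1, x ^ 2 ∂stableLevyMeasure α = 1 / (2 - α) := by
    simpa using setIntegral_Iio_pow_stableLevyMeasure (p := 2)
      (by push_cast; linarith [hα.2]) zero_le_one
  have htail := (isSubordinatorLevyMeasure_stableLevyMeasure hα).le_measureReal_Ici zero_lt_one
    hX.charFun_map (a := θ / (1 - α)) (hmean ▸ div_lt_div_of_pos_right hθ.2 h1) hy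
  rw [hmean, hsq, measureReal_Ici_stableLevyMeasure hα0 hy0,
    map_measureReal_apply_of_aemeasurable hX.aemeasurable measurableSet_Ici] at htail
  refine le_trans ?_ htail
  have hvar : 0 < 2 - α := by linarith
  gcongr
  · exact two_thirds_mul_sq_le hα hθ
  · exact one_div_one_add_le_one_sub_exp_neg (by positivity)

end IsTotallyAsymmetricStable

end StableLaw

theorem theorem6 {Ω : Type*} [MeasurableSpace Ω] (P : Measure Ω) [IsProbabilityMeasure P]
    (α : ℝ) (hα : α ∈ Set.Ioo (0 : ℝ) 1) (X : Ω → ℝ)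
    (hX : IsTotallyAsymmetricStable α X P) :
    (∀ y : ℝ, (1 / α) ^ (1 / α) ≤ y →
      P.real {ω | X ω > 1 / (1 - α) + 3 * y} ≤ 2 / (α * y ^ α)) ∧
    (∀ y θ : ℝ, 1 ≤ y → θ ∈ Set.Ioo (0 : ℝ) 1 →
      P.real {ω | X ω ≥ θ / (1 - α) + y} ≥
        2 / 3 * (1 - θ) ^ 2 * (1 / (1 + α * y ^ α))) := by
  refine ⟨fun y hy ↦ ?_, fun y θ hy hθ ↦ ?_⟩
  · have hpos : 0 < (1 / α) ^ (1 / α) := Real.rpow_pos_of_pos (one_div_pos.2 hα.1) _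
    exact hX.measureReal_gt_le hα (hpos.trans_le hy)
  · exact hX.le_measureReal_ge hα hy (Ioo_subset_Ico_self hθ)
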